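/- Let $f_0=f_1=1$ and $f_n=f_{n-1}+f_{n-2}$ for $n\ge 2$ be the Fibonacci numbers, and let $r,s\in\mathbb R\setminus\{0\}$. For a real sequence $x=(x_n)_{n\ge 0}$ let $\hat F(r,s)(x)$ be the sequence with terms $$\hat F(r,s)_0(x)=r\frac{f_0}{f_1}x_0,\qquad \hat F(r,s)_n(x)=r\frac{f_n}{f_{n+1}}x_n+s\frac{f_{n+1}}{f_n}x_{n-1}\quad(n\ge 1).$$ For $1\le p<\infty$ let $l_p(\hat F(r,s))$ be the Banach space of all real sequences $x$ with $\hat F(r,s)(x)\in l_p$, with the norm $\|x\|=\bigl(\sum_{n=0}^{\infty}|\hat F(r,s)_n(x)|^p\bigr)^{1/p}$. A Banach space $X$ has the weak fixed point property if for every nonempty, weakly compact, convex set $C\subseteq X$, every map $T:C\to C$ with $\|Tx-Ty\|\le\|x-y\|$ for all $x,y\in C$ has a fixed point. Theorem. If $1<p<\infty$, then $l_p(\hat F(r,s))$ has the weak fixed point property. -/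

import Mathlib

open scoped ENNReal

noncomputable section

/-- The Fibonacci numbers normalised by `f₀ = f₁ = 1`, `fₙ = fₙ₋₁ + fₙ₋₂`, as real numbers
(Mathlib's `Nat.fib` starts with `0, 1`). -/
def fibSeq (n : ℕ) : ℝ := (Nat.fib (n + 1) : ℝ)

/-- The infinite band matrix `F̂(r,s)`: the entry in row `n`, column `k` is `s fₙ₊₁ / fₙ` for
`k = n - 1`, `r fₙ / fₙ₊₁` for `k = n`, and `0` otherwise. -/
def fibMatrix (r s : ℝ) : Matrix ℕ ℕ ℝ := fun n k =>
  if k + 1 = n then s * (fibSeq (n + 1) / fibSeq n)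
  else if k = n then r * (fibSeq n / fibSeq (n + 1))
  else 0

/-- The `F̂(r,s)`-transform of a real sequence, as a linear map on the space of all sequences:
`y₀ = r (f₀/f₁) x₀` and `yₙ = r (fₙ/fₙ₊₁) xₙ + s (fₙ₊₁/fₙ) xₙ₋₁` for `n ≥ 1`. -/
def fibTransform (r s : ℝ) : (ℕ → ℝ) →ₗ[ℝ] (ℕ → ℝ) where
  toFun x n :=
    match n with
    | 0 => r * (fibSeq 0 / fibSeq 1) * x 0
    | m + 1 => r * (fibSeq (m + 1) / fibSeq (m + 2)) * x (m + 1)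
        + s * (fibSeq (m + 2) / fibSeq (m + 1)) * x m
  map_add' x y := by
    funext n
    cases n <;> simp <;> ring
  map_smul' c x := by
    funext n
    cases n <;> simp <;> ring

theorem fibTransform_zero (r s : ℝ) (x : ℕ → ℝ) :
    fibTransform r s x 0 = r * (fibSeq 0 / fibSeq 1) * x 0 := rfl

theorem fibTransform_succ (r s : ℝ) (x : ℕ → ℝ) (m : ℕ) :
    fibTransform r s x (m + 1) = r * (fibSeq (m + 1) / fibSeq (m + 2)) * x (m + 1)
      + s * (fibSeq (m + 2) / fibSeq (m + 1)) * x m := rfl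

/-- `fibTransform` is the matrix transform `x ↦ (∑ₖ F̂(r,s)ₙₖ xₖ)ₙ`. -/
theorem fibTransform_hasSum (r s : ℝ) (x : ℕ → ℝ) (n : ℕ) :
    HasSum (fun k => fibMatrix r s n k * x k) (fibTransform r s x n) := by
  cases n with
  | zero =>
    have h := hasSum_single (f := fun k => fibMatrix r s 0 k * x k) 0
      (by intro k hk; simp [fibMatrix, hk])
    simpa [fibMatrix, fibTransform_zero] using h
  | succ m =>
    have h := hasSum_sum_of_ne_finset_zero (f := fun k => fibMatrix r s (m + 1) k * x k)
      (s := {m, m + 1}) (L := SummationFilter.unconditional ℕ)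
      (by
        intro k hk
        simp only [Finset.mem_insert, Finset.mem_singleton, not_or] at hk
        simp [fibMatrix, hk.1, hk.2])
    have e : ∑ k ∈ ({m, m + 1} : Finset ℕ), fibMatrix r s (m + 1) k * x k
        = fibTransform r s x (m + 1) := by
      rw [Finset.sum_pair (by omega)]
      simp [fibMatrix, fibTransform_succ]
      ring
    rwa [e] at h

theorem fibSeq_pos (n : ℕ) : 0 < fibSeq n := by
  unfold fibSeq
  exact_mod_cast Nat.fib_pos.2 n.succ_pos

theorem fibTransform_bijective (r s : ℝ) [hr : NeZero r] :
    Function.Bijective (fibTransform r s) := by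
  have hc : ∀ n, r * (fibSeq n / fibSeq (n + 1)) ≠ 0 := fun n =>
    mul_ne_zero hr.out (div_pos (fibSeq_pos n) (fibSeq_pos (n + 1))).ne'
  constructor
  · rw [injective_iff_map_eq_zero]
    intro x hx
    funext n
    induction n with
    | zero =>
      have h := congrFun hx 0
      rw [fibTransform_zero] at h
      exact (mul_eq_zero.1 h).resolve_left (hc 0)
    | succ m ih =>
      have h := congrFun hx (m + 1)
      rw [fibTransform_succ, ih] at h
      simp only [Pi.zero_apply, mul_zero, add_zero] at h
      exact (mul_eq_zero.1 h).resolve_left (hc (m + 1))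
  · intro y
    let x : ℕ → ℝ := fun n => Nat.rec (y 0 / (r * (fibSeq 0 / fibSeq 1)))
      (fun m a => (y (m + 1) - s * (fibSeq (m + 2) / fibSeq (m + 1)) * a)
        / (r * (fibSeq (m + 1) / fibSeq (m + 2)))) n
    refine ⟨x, ?_⟩
    funext n
    cases n with
    | zero =>
      rw [fibTransform_zero]
      exact mul_div_cancel₀ _ (hc 0)
    | succ m =>
      rw [fibTransform_succ]
      have h : x (m + 1) = (y (m + 1) - s * (fibSeq (m + 2) / fibSeq (m + 1)) * x m)
        / (r * (fibSeq (m + 1) / fibSeq (m + 2))) := rfl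
      rw [h, mul_div_cancel₀ _ (hc (m + 1))]
      ring

/-- The matrix domain of `F̂(r,s)` in `ℓᵖ`: all real sequences whose transform lies in `ℓᵖ`. -/
def fibLpSubmodule (r s : ℝ) (p : ℝ≥0∞) : Submodule ℝ (ℕ → ℝ) where
  carrier := {x | Memℓp (fibTransform r s x) p}
  zero_mem' := by
    simp only [Set.mem_ofPred_eq, map_zero]
    exact zero_memℓp
  add_mem' := by
    intro x y hx hy
    simp only [Set.mem_ofPred_eq, map_add] at *
    exact hx.add hy
  smul_mem' := by
    intro c x hx
    simp only [Set.mem_ofPred_eq, map_smul] at *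
    exact hx.const_smul c

/-- The sequence space `ℓᵖ(F̂(r,s))`. It is a type of its own, so that it does not carry the
topology of coordinatewise convergence as a second topology. -/
def FibLp (r s : ℝ) (p : ℝ≥0∞) : Type := fibLpSubmodule r s p

namespace FibLp

variable {r s : ℝ} {p : ℝ≥0∞}

instance : AddCommGroup (FibLp r s p) := inferInstanceAs (AddCommGroup (fibLpSubmodule r s p))

instance : Module ℝ (FibLp r s p) := inferInstanceAs (Module ℝ (fibLpSubmodule r s p))

/-- The transform as a linear map from `ℓᵖ(F̂(r,s))` to `ℓᵖ`. -/
def toLp (r s : ℝ) (p : ℝ≥0∞) : FibLp r s p →ₗ[ℝ] lp (fun _ : ℕ => ℝ) p where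
  toFun x := ⟨fibTransform r s x.1, x.2⟩
  map_add' x y := Subtype.ext ((fibTransform r s).map_add x.1 y.1)
  map_smul' c x := Subtype.ext ((fibTransform r s).map_smul c x.1)

theorem toLp_bijective [NeZero r] : Function.Bijective (toLp r s p) := by
  constructor
  · intro x y h
    exact Subtype.ext ((fibTransform_bijective r s).1 (congrArg Subtype.val h))
  · rintro ⟨y, hy⟩
    obtain ⟨x, rfl⟩ := (fibTransform_bijective r s).2 y
    exact ⟨⟨x, hy⟩, rfl⟩

/-- The norm of `ℓᵖ(F̂(r,s))`: the `ℓᵖ` norm of the transform. -/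
instance [NeZero r] [Fact (1 ≤ p)] : NormedAddCommGroup (FibLp r s p) :=
  NormedAddCommGroup.induced _ _ (toLp r s p) toLp_bijective.1

instance [NeZero r] [Fact (1 ≤ p)] : NormedSpace ℝ (FibLp r s p) :=
  NormedSpace.induced ℝ _ _ (toLp r s p)

/-- For `p < ∞` the norm is `(∑ₙ |F̂(r,s)ₙ(x)|ᵖ)^(1/p)`. -/
theorem norm_eq [NeZero r] [Fact (1 ≤ p)] (hp : p ≠ ∞) (x : FibLp r s p) :
    ‖x‖ = (∑' n, |fibTransform r s x.1 n| ^ p.toReal) ^ (1 / p.toReal) :=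
  lp.norm_eq_tsum_rpow
    (ENNReal.toReal_pos (zero_lt_one.trans_le (Fact.out : 1 ≤ p)).ne' hp) (toLp r s p x)

instance [NeZero r] [Fact (1 ≤ p)] : CompleteSpace (FibLp r s p) := by
  have hi : Isometry (toLp r s p) := AddMonoidHomClass.isometry_of_norm _ fun _ => rfl
  exact (completeSpace_congr (e := Equiv.ofBijective _ toLp_bijective)
    hi.isUniformInducing.isUniformEmbedding).2 inferInstance

end FibLp

/-- The weak fixed point property of a Banach space `X`: for every nonempty, weakly compact,
convex subset `C` of `X`, every nonexpansive map from `C` to `C` has a fixed point. -/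
def WeakFixedPointProperty (X : Type*) [NormedAddCommGroup X] [NormedSpace ℝ X]
    [CompleteSpace X] : Prop :=
  ∀ C : Set X, C.Nonempty → Convex ℝ C → IsCompact (toWeakSpace ℝ X '' C) →
    ∀ T : C → C, (∀ x y : C, ‖(T x : X) - (T y : X)‖ ≤ ‖(x : X) - (y : X)‖) →
      ∃ x : C, T x = x

end

open Filter Topology

/-! The transform is a linear isometry into `ℓᵖ`, where an Opial-type argument applies. Let `u n` be
approximate fixed points of `T` with weak limit `x` along an ultrafilter, and let `a` be the limit
of `‖u n - x‖`. Nonexpansiveness gives `‖u n - T x‖ ≤ ‖u n - T (u n)‖ + ‖u n - x‖`, whose right side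
also tends to `a`. As `u n - x` tends to zero coordinatewise, Brezis–Lieb yields `‖T x - x‖ ^ p + a
^ p ≤ a ^ p`, so `T x = x`. -/

/-- A **Brezis–Lieb inequality** in `ℓᵖ`: for a family `v` tending to zero coordinatewise, the
`p`-th powers of the norms of `v` and of a translation vector `d` add up in the limit. -/
theorem lp.norm_rpow_add_rpow_le_of_tendsto_zero {ι κ : Type*} {E : ι → Type*}
    [∀ i, NormedAddCommGroup (E i)] {p : ℝ≥0∞} [Fact (1 ≤ p)] (hp : p ≠ ∞)
    {l : Filter κ} [l.NeBot] {v : κ → lp E p} {d : lp E p} {c : κ → ℝ} {a b : ℝ}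
    (hv : ∀ i, Tendsto (fun k => v k i) l (𝓝 0))
    (ha : Tendsto (fun k => ‖v k‖) l (𝓝 a)) (hb : Tendsto c l (𝓝 b))
    (hc : ∀ k, ‖v k - d‖ ≤ c k) :
    ‖d‖ ^ p.toReal + a ^ p.toReal ≤ b ^ p.toReal := by
  classical
  have hp0 : 0 < p := zero_lt_one.trans_le Fact.out
  have hp' : 0 < p.toReal := ENNReal.toReal_pos hp0.ne' hp
  have ha0 : 0 ≤ a := ge_of_tendsto' ha fun _ => norm_nonneg _
  have hpow : ∀ {m : Filter κ} {g : κ → ℝ} {y : ℝ}, Tendsto g m (𝓝 y) →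
      Tendsto (fun k => g k ^ p.toReal) m (𝓝 (y ^ p.toReal)) := fun h =>
    h.rpow_const (Or.inr hp'.le)
  -- Split the coordinates at `s`. On `s` the vector `v k` dies out and leaves `d`; off `s` the
  -- triangle inequality leaves at least `a` minus the tail of `d`. The `max 0` keeps the base of
  -- the power nonnegative.
  have key : ∀ s : Finset ι, ∑ i ∈ s, ‖d i‖ ^ p.toReal
      + max 0 (a - ‖d - ∑ i ∈ s, lp.single p i (d i)‖) ^ p.toReal ≤ b ^ p.toReal := by
    intro s
    have hhead : Tendsto (fun k => ∑ i ∈ s, ‖(v k - d) i‖ ^ p.toReal) l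
        (𝓝 (∑ i ∈ s, ‖d i‖ ^ p.toReal)) := by
      refine tendsto_finsetSum _ fun i _ => hpow ?_
      simpa using ((hv i).sub_const (d i)).norm
    have hproj : Tendsto (fun k => ‖∑ i ∈ s, lp.single p i (v k i)‖) l (𝓝 0) := by
      refine squeeze_zero (fun _ => norm_nonneg _) (fun k => norm_sum_le _ _) ?_
      simp only [lp.norm_single hp0]
      simpa using tendsto_finsetSum s fun i _ => (hv i).norm
    have htail : Tendsto (fun k => max 0 (‖v k‖ - ‖∑ i ∈ s, lp.single p i (v k i)‖
        - ‖d - ∑ i ∈ s, lp.single p i (d i)‖) ^ p.toReal) l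
        (𝓝 (max 0 (a - ‖d - ∑ i ∈ s, lp.single p i (d i)‖) ^ p.toReal)) := by
      refine hpow (tendsto_const_nhds.max ?_)
      simpa using (ha.sub hproj).sub_const ‖d - ∑ i ∈ s, lp.single p i (d i)‖
    refine le_of_tendsto_of_tendsto' (hhead.add htail) (hpow hb) fun k => ?_
    have h1 := lp.norm_compl_sum_single hp' (v k - d) s
    have h2 : max 0 (‖v k‖ - ‖∑ i ∈ s, lp.single p i (v k i)‖
        - ‖d - ∑ i ∈ s, lp.single p i (d i)‖) ≤
        ‖v k - d - ∑ i ∈ s, lp.single p i ((v k - d) i)‖ := by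
      refine max_le (norm_nonneg _) ?_
      have h3 : v k - d - ∑ i ∈ s, lp.single p i ((v k - d) i)
          = v k - ∑ i ∈ s, lp.single p i (v k i) - (d - ∑ i ∈ s, lp.single p i (d i)) := by
        simp only [lp.coeFn_sub, Pi.sub_apply, lp.single_sub, Finset.sum_sub_distrib]
        abel
      rw [h3]
      have h4 := norm_sub_norm_le (v k - ∑ i ∈ s, lp.single p i (v k i))
        (d - ∑ i ∈ s, lp.single p i (d i))
      have h5 := norm_sub_norm_le (v k) (∑ i ∈ s, lp.single p i (v k i))
      linarith
    have h6 := Real.rpow_le_rpow (le_max_left _ _) h2 hp'.le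
    have h7 := Real.rpow_le_rpow (norm_nonneg _) (hc k) hp'.le
    linarith
  have hrest : Tendsto (fun s : Finset ι => ‖d - ∑ i ∈ s, lp.single p i (d i)‖) atTop (𝓝 0) := by
    have h := (lp.hasSum_single hp d : Tendsto _ _ _)
    simpa using (tendsto_const_nhds (x := d)).sub h |>.norm
  have hmax : Tendsto (fun s : Finset ι =>
      max 0 (a - ‖d - ∑ i ∈ s, lp.single p i (d i)‖) ^ p.toReal) atTop (𝓝 (a ^ p.toReal)) := by
    have h := (tendsto_const_nhds (x := (0 : ℝ))).max (hrest.const_sub a)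
    rw [sub_zero, max_eq_right ha0] at h
    exact h.rpow_const (Or.inr hp'.le)
  exact le_of_tendsto' (Tendsto.add (lp.hasSum_norm hp' d : Tendsto _ _ _) hmax) key

section WeaklyCompact

variable {X : Type*} [NormedAddCommGroup X] [NormedSpace ℝ X] {C : Set X}

theorem isClosed_of_isCompact_toWeakSpace_image (hC : IsCompact (toWeakSpace ℝ X '' C)) :
    IsClosed C := by
  have h := hC.isClosed.preimage (toWeakSpaceCLM ℝ X).continuous
  have e : toWeakSpaceCLM ℝ X ⁻¹' (toWeakSpace ℝ X '' C) = C :=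
    Set.preimage_image_eq C (toWeakSpace ℝ X).injective
  rwa [e] at h

theorem continuous_strongDual_toWeakSpace_symm (f : StrongDual ℝ X) :
    Continuous fun x : WeakSpace ℝ X => f ((toWeakSpace ℝ X).symm x) :=
  WeakBilin.eval_continuous (topDualPairing ℝ X).flip f

/-- Weakly compact sets are bounded, by the uniform boundedness principle. -/
theorem exists_norm_le_of_isCompact_toWeakSpace_image
    (hC : IsCompact (toWeakSpace ℝ X '' C)) : ∃ M, ∀ x ∈ C, ‖x‖ ≤ M := by
  obtain ⟨M, hM⟩ := banach_steinhaus
    (g := fun x : C => NormedSpace.inclusionInDoubleDual ℝ X x) fun f => by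
      obtain ⟨K, hK⟩ := hC.exists_bound_of_continuousOn
        (continuous_strongDual_toWeakSpace_symm f).continuousOn
      refine ⟨K, fun x => ?_⟩
      simpa using hK _ (Set.mem_image_of_mem _ x.2)
  refine ⟨M, fun x hx => ?_⟩
  have h := hM ⟨x, hx⟩
  exact ((NormedSpace.inclusionInDoubleDualLi ℝ).norm_map x).symm.trans_le h

end WeaklyCompact

/-- A nonexpansive self-map of a nonempty bounded complete convex set has approximate fixed
points. -/
theorem exists_norm_sub_lt_of_nonexpansive {X : Type*} [NormedAddCommGroup X] [NormedSpace ℝ X]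
    {C : Set X} (hne : C.Nonempty) (hconv : Convex ℝ C) (hcomp : IsComplete C) {M : ℝ}
    (hM : ∀ x ∈ C, ‖x‖ ≤ M) (T : C → C)
    (hT : ∀ x y : C, ‖(T x : X) - (T y : X)‖ ≤ ‖(x : X) - (y : X)‖) {ε : ℝ} (hε : 0 < ε) :
    ∃ x : C, ‖(x : X) - (T x : X)‖ < ε := by
  obtain ⟨z, hz⟩ := hne
  have hM0 : 0 ≤ M := (norm_nonneg z).trans (hM z hz)
  obtain ⟨t, ht0, ht1, htε⟩ : ∃ t : ℝ, 0 < t ∧ t < 1 ∧ t * (2 * M) < ε := by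
    -- The `+ 1` avoids dividing by zero when `M = 0`.
    refine ⟨min (1 / 2) (ε / (2 * M + 1)), by positivity,
      (min_le_left _ _).trans_lt (by norm_num), ?_⟩
    have h1 : min (1 / 2) (ε / (2 * M + 1)) * (2 * M + 1) ≤ ε :=
      (le_div_iff₀ (by positivity)).1 (min_le_right _ _)
    have h2 : 0 < min (1 / 2) (ε / (2 * M + 1)) := by positivity
    linarith
  -- Pulling `T` towards `z` makes it a contraction; at its fixed point `x - T x = t • (z - T x)`,
  -- of norm at most `2 * M * t`.
  let S : C → C := fun x => ⟨(1 - t) • (T x : X) + t • z,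
    hconv (T x).2 hz (by linarith) ht0.le (by ring)⟩
  have hS : ContractingWith (1 - t).toNNReal S := by
    refine ⟨?_, LipschitzWith.of_dist_le_mul fun x y => ?_⟩
    · rw [Real.toNNReal_lt_one]
      linarith
    · have e : (S x : X) - S y = (1 - t) • ((T x : X) - T y) := by
        simp only [S, smul_sub]
        abel
      rw [Subtype.dist_eq, Subtype.dist_eq, dist_eq_norm, dist_eq_norm, e, norm_smul,
        Real.norm_of_nonneg (by linarith), Real.coe_toNNReal _ (by linarith)]
      exact mul_le_mul_of_nonneg_left (hT x y) (by linarith)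
  have := hcomp.completeSpace_coe
  have : Nonempty C := ⟨⟨z, hz⟩⟩
  refine ⟨hS.fixedPoint, ?_⟩
  set x := hS.fixedPoint
  have hx : (1 - t) • (T x : X) + t • z = x := congrArg Subtype.val hS.fixedPoint_isFixedPt
  have e : (x : X) - T x = t • (z - T x) := by
    nth_rewrite 1 [← hx]
    module
  rw [e, norm_smul, Real.norm_of_nonneg ht0.le]
  refine lt_of_le_of_lt (mul_le_mul_of_nonneg_left ?_ ht0.le) htε
  linarith [norm_sub_le z (T x : X), hM z hz, hM _ (T x).2]

/-- A Banach space that embeds linearly and isometrically into `ℓᵖ`, `p < ∞`, has the weak fixed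
point property. -/
theorem weakFixedPointProperty_of_linearIsometry_lp {ι X : Type*} [NormedAddCommGroup X]
    [NormedSpace ℝ X] [CompleteSpace X] {p : ℝ≥0∞} [Fact (1 ≤ p)] (hp : p ≠ ∞)
    (e : X →ₗᵢ[ℝ] lp (fun _ : ι => ℝ) p) : WeakFixedPointProperty X := by
  intro C hne hconv hcomp T hT
  have hp0 : 0 < p := zero_lt_one.trans_le Fact.out
  obtain ⟨M, hM⟩ := exists_norm_le_of_isCompact_toWeakSpace_image hcomp
  have happrox : ∀ n : ℕ, ∃ x : C, ‖(x : X) - (T x : X)‖ < 1 / ((n : ℝ) + 1) := fun n =>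
    exists_norm_sub_lt_of_nonexpansive hne hconv
      (isClosed_of_isCompact_toWeakSpace_image hcomp).isComplete hM T hT (by positivity)
  choose u hu using happrox
  -- Along an ultrafilter, compactness yields both the weak limit and the limit of norms without
  -- extracting subsequences.
  let U : Ultrafilter ℕ := hyperfilter ℕ
  obtain ⟨_, ⟨x, hx, rfl⟩, hlim⟩ := hcomp.ultrafilter_le_nhds
    (U.map fun n => toWeakSpace ℝ X (u n)) (by
      exact tendsto_principal.2 (.of_forall fun n => Set.mem_image_of_mem _ (u n).2))
  have hweak : Tendsto (fun n => toWeakSpace ℝ X (u n)) U (𝓝 (toWeakSpace ℝ X x)) := hlim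
  have hcoord : ∀ i, Tendsto (fun n => e ((u n : X) - x) i) U (𝓝 0) := by
    intro i
    -- Coordinates of `e` are bounded functionals, hence weakly continuous.
    let f : StrongDual ℝ X := LinearMap.mkContinuous
      { toFun := fun y => e y i
        map_add' := fun y z => by simp
        map_smul' := fun c y => by simp } 1 fun y => by
          simpa using lp.norm_apply_le_norm hp0.ne' (e y) i
    have h := ((continuous_strongDual_toWeakSpace_symm f).tendsto _).comp hweak
    have h' : Tendsto (fun n => e (u n : X) i) U (𝓝 (e x i)) := h
    simpa using h'.sub_const (e x i)
  obtain ⟨a, -, ha⟩ := (isCompact_Icc (a := (0 : ℝ)) (b := M + M)).ultrafilter_le_nhds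
    (U.map fun n => ‖e ((u n : X) - x)‖) (by
      refine tendsto_principal.2 (.of_forall fun n => ⟨norm_nonneg _, ?_⟩)
      rw [e.norm_map]
      exact (norm_sub_le _ _).trans (add_le_add (hM _ (u n).2) (hM x hx)))
  have ha' : Tendsto (fun n => ‖e ((u n : X) - x)‖) U (𝓝 a) := ha
  have hU : (U : Filter ℕ) ≤ atTop := by
    rw [← Nat.cofinite_eq_atTop]
    exact hyperfilter_le_cofinite
  have hb : Tendsto (fun n : ℕ => 1 / ((n : ℝ) + 1) + ‖e ((u n : X) - x)‖) U (𝓝 a) := by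
    simpa using (tendsto_one_div_add_atTop_nhds_zero_nat.mono_left hU).add ha'
  have hle := lp.norm_rpow_add_rpow_le_of_tendsto_zero hp (d := e (T ⟨x, hx⟩ - x)) hcoord ha' hb
    fun n => by
      rw [← map_sub, e.norm_map, e.norm_map]
      have h1 : (u n : X) - x - (T ⟨x, hx⟩ - x) = (u n - T (u n)) + (T (u n) - T ⟨x, hx⟩) := by
        abel
      rw [h1]
      exact (norm_add_le _ _).trans (add_le_add (hu n).le (hT _ _))
  have hzero : ‖e (T ⟨x, hx⟩ - x)‖ ^ p.toReal ≤ 0 := by linarith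
  refine ⟨⟨x, hx⟩, Subtype.ext (sub_eq_zero.1 (norm_eq_zero.1 ?_))⟩
  rw [e.norm_map] at hzero
  by_contra hne0
  exact hzero.not_gt
    (Real.rpow_pos_of_pos ((norm_nonneg _).lt_of_ne' hne0) _)

theorem theorem5p4 (r s : ℝ) [NeZero r] [NeZero s] (p : ℝ≥0∞) [Fact (1 ≤ p)]
    (hp_one : 1 < p) (hp_top : p < ∞) :
    WeakFixedPointProperty (FibLp r s p) :=
  weakFixedPointProperty_of_linearIsometry_lp hp_top.ne
    { toLinearMap := FibLp.toLp r s p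
      norm_map' := fun _ => rfl }
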